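/- Fix a countably infinite set $X$ of variables. An NNF over $X$ is a finite node-labelled directed acyclic graph with a unique sink (the output gate), whose sources are labelled by constants $0,1$ or literals $x,\neg x$ ($x\in X$) and whose other nodes (gates) are labelled by $\wedge$ or $\vee$; its size is its number of arcs, and it computes a Boolean function of the assignments $X\to\{0,1\}$ in the usual way. A DNNF is an NNF such that, for every $\wedge$-gate $v$ and any two distinct gates $u,u'$ with arcs into $v$, no variable occurs both in the subcircuit ending at $u$ and in the subcircuit ending at $u'$. A $2$-DNF is a disjunction of terms, each a literal or a conjunction of at most two literals, viewed as an NNF with a $\vee$-gate as output. There exist a class $\mathcal{D}$ of $2$-DNFs, all of which are DNNFs, containing formulas of arbitrarily large size, and a constant $c>0$ such that, for every $D\in\mathcal{D}$, every DNNF equivalent to $\neg D$ has size at least $2^{c\cdot\mathrm{size}(D)}$. Consequently, DNNFs are not closed under negation with polynomial size increase: there is no polynomial $p$ such that for every DNNF $D$ there is a DNNF equivalent to $\neg D$ of size at most $p(\mathrm{size}(D))$. -/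

import Mathlib

/-- Labels of the gates of a circuit in negation normal form over the variables `X`.
`lit x true` is the literal `x` and `lit x false` is the literal `¬ x`. -/
inductive GateLabel (X : Type*) where
  | const (b : Bool) : GateLabel X
  | lit (x : X) (b : Bool) : GateLabel X
  | and : GateLabel X
  | or : GateLabel X

/-- The labels allowed at input gates: constants and literals. -/
def GateLabel.IsInput {X : Type*} : GateLabel X → Prop
  | .const _ => True
  | .lit _ _ => True
  | .and => False
  | .or => False

/-- A circuit in negation normal form over the variables `X`: a finite node-labelled directed
acyclic graph with a unique sink (the output gate), whose sources are labelled by constants or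
literals and whose other nodes are labelled by `∧` or `∨`. `Wire u v` says that there is a wire
from `u` to `v`. -/
structure NNF (X : Type*) where
  Gate : Type
  finite_gate : Finite Gate
  Wire : Gate → Gate → Prop
  acyclic : ∀ v, ¬ Relation.TransGen Wire v v
  label : Gate → GateLabel X
  source_iff : ∀ v, (∀ u, ¬ Wire u v) ↔ (label v).IsInput
  out : Gate
  sink_iff : ∀ v, (∀ w, ¬ Wire v w) ↔ v = out

namespace NNF

variable {X : Type*}

instance (C : NNF X) : Finite C.Gate := C.finite_gate

/-- The size of a circuit is its number of wires. -/
noncomputable def size (C : NNF X) : ℕ :=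
  Nat.card {p : C.Gate × C.Gate // C.Wire p.1 p.2}

/-- `C.Holds f v`: the subcircuit of `C` sinked at `v` has value `1` under the assignment `f`.
See `holds_const`, `holds_lit`, `holds_and`, `holds_or` for the evaluation rules. -/
inductive Holds (C : NNF X) (f : X → Bool) : C.Gate → Prop
  | const {v : C.Gate} (h : C.label v = .const true) : Holds C f v
  | lit {v : C.Gate} {x : X} {b : Bool} (h : C.label v = .lit x b) (hf : f x = b) : Holds C f v
  | and {v : C.Gate} (h : C.label v = .and) (hu : ∀ u, C.Wire u v → Holds C f u) : Holds C f v
  | or {v u : C.Gate} (h : C.label v = .or) (w : C.Wire u v) (hu : Holds C f u) : Holds C f v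

theorem holds_const (C : NNF X) (f : X → Bool) {v : C.Gate} {b : Bool}
    (h : C.label v = .const b) : C.Holds f v ↔ b = true := by
  constructor
  · rintro (h' | ⟨h', -⟩ | ⟨h', -⟩ | ⟨h', -, -⟩) <;> simp_all
  · rintro rfl
    exact .const h

theorem holds_lit (C : NNF X) (f : X → Bool) {v : C.Gate} {x : X} {b : Bool}
    (h : C.label v = .lit x b) : C.Holds f v ↔ f x = b := by
  constructor
  · rintro (h' | ⟨h', hf⟩ | ⟨h', -⟩ | ⟨h', -, -⟩) <;> simp_all
  · exact .lit h

theorem holds_and (C : NNF X) (f : X → Bool) {v : C.Gate} (h : C.label v = .and) :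
    C.Holds f v ↔ ∀ u, C.Wire u v → C.Holds f u := by
  constructor
  · rintro (h' | ⟨h', -⟩ | ⟨-, hu⟩ | ⟨h', -, -⟩) <;> simp_all
  · exact .and h

theorem holds_or (C : NNF X) (f : X → Bool) {v : C.Gate} (h : C.label v = .or) :
    C.Holds f v ↔ ∃ u, C.Wire u v ∧ C.Holds f u := by
  constructor
  · intro hv
    cases hv with
    | const h' => simp_all
    | lit h' _ => simp_all
    | and h' _ => simp_all
    | or _ w hu => exact ⟨_, w, hu⟩
  · rintro ⟨u, w, hu⟩
    exact .or h w hu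

/-- The assignment `f` satisfies `C`, that is, `C` has value `1` under `f`. -/
def Sat (C : NNF X) (f : X → Bool) : Prop := C.Holds f C.out

/-- `C'` is equivalent to the negation of `C`: under every assignment, `C'` and `C` have
opposite values. -/
def EquivNeg (C' C : NNF X) : Prop := ∀ f : X → Bool, C'.Sat f ↔ ¬ C.Sat f

/-- The variables of the subcircuit of `C` sinked at `v`: those labelling an input gate from which
there is a (possibly trivial) directed path to `v`. -/
def subVars (C : NNF X) (v : C.Gate) : Set X :=
  {x | ∃ (u : C.Gate) (b : Bool), Relation.ReflTransGen C.Wire u v ∧ C.label u = .lit x b}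

/-- A DNNF is a decomposable NNF: the subcircuits leading into an `∧`-gate have pairwise disjoint
sets of variables. -/
def IsDNNF (C : NNF X) : Prop :=
  ∀ v, C.label v = .and → ∀ u u', C.Wire u v → C.Wire u' v → u ≠ u' →
    Disjoint (C.subVars u) (C.subVars u')

/-- A DNF: the output gate is an `∨`-gate (a disjunction of terms), every other gate is a
literal or an `∧`-gate, and `∧`-gates receive wires only from literals. Thus
each wire into the output gate comes from a term, which is a conjunction of literals or
a single literal. -/
def IsDNF (C : NNF X) : Prop :=
  C.label C.out = .or ∧
  (∀ v, v ≠ C.out → C.label v = .and ∨ ∃ x b, C.label v = .lit x b) ∧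
  (∀ v, C.label v = .and → ∀ u, C.Wire u v → ∃ x b, C.label u = .lit x b)

/-- A `k`-DNF: a DNF whose `∧`-gates have fanin at most `k`. -/
def IsKDNF (k : ℕ) (C : NNF X) : Prop :=
  C.IsDNF ∧ ∀ v, C.label v = .and → Nat.card {u : C.Gate // C.Wire u v} ≤ k

end NNF

/-! The hard formulas come from expander-like multigraphs on 3k vertices: bounded degree, O(k)
edges, no loops, and at least k edges across every cut with both sides of size at least k. With one
variable per vertex, D is the disjunction over the edges uv of ¬u ∧ ¬v, so the models of ¬D are the
vertex covers.

A DNNF of size s has its models covered by at most s + 1 rectangles, each with respect to a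
partition of the variables that is balanced on the vertices (`NNF.exists_balanced_rect_cover`).
Inside one rectangle, every edge across the partition has an endpoint lying in all covers of the
rectangle: otherwise one cover omits the first endpoint, another omits the second, and their mixture
is a model covering neither. These forced endpoints form a set F covering at least k edges, so F has
at least k/d elements, where d bounds the degree.

Forcing a vertex is costly: each vertex of F divides the number of covers by at least 1 + 2^(-d)
(`card_coversContaining_insert`). Each rectangle thus holds an exponentially small fraction of all
covers, and exponentially many are needed (`NNF.pow_le_size_add_one`). The graphs come from a union
bound over random edge lists, followed by deletion of loops and of edges at high-degree vertices
(`exists_expander`). -/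

/-! ### Random edge lists and expanding multigraphs -/

/-- Markov's inequality for the product of the values of a weight at independent samples. -/
theorem card_le_prod_mul_le {α : Type*} [Fintype α] (w : α → ℝ) (hw : ∀ a, 0 ≤ w a)
    {ρ θ : ℝ} (hρ : ∑ a, w a ≤ ρ) (m : ℕ) (S : Finset (Fin m → α))
    (hS : ∀ e ∈ S, θ ≤ ∏ i, w (e i)) : (S.card : ℝ) * θ ≤ ρ ^ m := by
  calc (S.card : ℝ) * θ = ∑ _e ∈ S, θ := by simp
    _ ≤ ∑ e ∈ S, ∏ i, w (e i) := Finset.sum_le_sum hS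
    _ ≤ ∑ e : Fin m → α, ∏ i, w (e i) :=
        Finset.sum_le_sum_of_subset_of_nonneg (Finset.subset_univ _)
          fun e _ _ => Finset.prod_nonneg fun i _ => hw _
    _ = (∑ a, w a) ^ m := by rw [Fintype.sum_pow]
    _ ≤ ρ ^ m := pow_le_pow_left₀ (Finset.sum_nonneg fun a _ => hw a) hρ m

theorem prod_ite_eq_pow_card {ι : Type*} [Fintype ι] (P : ι → Prop) [DecidablePred P] (t : ℝ) :
    ∏ i, (if P i then t else 1) = t ^ (Finset.univ.filter P).card := by
  rw [Finset.prod_ite]; simp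

theorem sum_ite_eq_card {α : Type*} [Fintype α] (P : α → Prop) [DecidablePred P] (t : ℝ) :
    ∑ a, (if P a then t else 1)
      = (Fintype.card α : ℝ) + (t - 1) * ((Finset.univ.filter P).card : ℝ) := by
  have : ∀ a, (if P a then t else 1) = (1 : ℝ) + (t - 1) * (if P a then 1 else 0) := by
    intro a; split_ifs <;> ring
  simp only [this, Finset.sum_add_distrib, ← Finset.mul_sum, Finset.sum_boole]
  simp

/-- The ordered pair `p` crosses the cut given by `A`. -/
def CrossesCut {V : Type*} (A : Finset V) (p : V × V) : Prop := ¬ (p.1 ∈ A ↔ p.2 ∈ A)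

/-- The ordered pair `p` has an endpoint in `H`. -/
def Touches {V : Type*} (H : Finset V) (p : V × V) : Prop := p.1 ∈ H ∨ p.2 ∈ H

section Counting

open Classical

variable {V : Type*} [Fintype V]

theorem card_crossesCut (A : Finset V) :
    2 * (A.card * (Finset.univ \ A).card) ≤
      (Finset.univ.filter fun p : V × V => CrossesCut A p).card := by
  have h : (A ×ˢ (Finset.univ \ A)) ∪ ((Finset.univ \ A) ×ˢ A) ⊆
      Finset.univ.filter fun p : V × V => CrossesCut A p := by
    intro p hp
    refine Finset.mem_filter.2 ⟨Finset.mem_univ _, ?_⟩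
    simp only [Finset.mem_union, Finset.mem_product, Finset.mem_sdiff, Finset.mem_univ, true_and,
      CrossesCut] at hp ⊢
    tauto
  refine le_trans (le_of_eq ?_) (Finset.card_le_card h)
  rw [Finset.card_union_of_disjoint, Finset.card_product, Finset.card_product]
  · ring
  · rw [Finset.disjoint_left]
    intro p hp hp'
    simp only [Finset.mem_product, Finset.mem_sdiff, Finset.mem_univ, true_and] at hp hp'
    tauto

theorem card_touches (H : Finset V) :
    (Finset.univ.filter fun p : V × V => Touches H p).card ≤ 2 * (H.card * Fintype.card V) := by
  have h : (Finset.univ.filter fun p : V × V => Touches H p) ⊆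
      (H ×ˢ Finset.univ) ∪ (Finset.univ ×ˢ H) := by
    intro p hp
    simpa [Touches] using (Finset.mem_filter.1 hp).2
  refine (Finset.card_le_card h).trans ((Finset.card_union_le _ _).trans (le_of_eq ?_))
  rw [Finset.card_product, Finset.card_product, Finset.card_univ]
  ring

/-- Chernoff-type bound, with n = 3k. A random pair crosses a balanced cut with probability at least
4/9, so giving crossing pairs weight 1/4 makes the mean weight at most 1 - (3/4)(4/9) = 2/3.
Markov's inequality bounds the bad fraction by (2/3)^(11n) · 16^n, and (2/3)^11 · 16 ≤ 1/4. -/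
theorem card_few_crossing {k : ℕ} (hV : Fintype.card V = 3 * k) (A : Finset V)
    (h1 : k ≤ A.card) (h2 : A.card ≤ 2 * k) :
    ((Finset.univ.filter fun e : Fin (11 * (3 * k)) → V × V =>
      (Finset.univ.filter fun i => CrossesCut A (e i)).card ≤ 2 * (3 * k)).card : ℝ) ≤
      (1 / 4) ^ (3 * k) * ((3 * k : ℝ) ^ 2) ^ (11 * (3 * k)) := by
  have key := card_le_prod_mul_le (fun p : V × V => if CrossesCut A p then (1 / 4 : ℝ) else 1)
    (fun a => by split_ifs <;> norm_num) (ρ := 2 / 3 * (3 * k : ℝ) ^ 2)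
    (θ := (1 / 4 : ℝ) ^ (2 * (3 * k))) ?_ (11 * (3 * k))
    (Finset.univ.filter fun e : Fin (11 * (3 * k)) → V × V =>
      (Finset.univ.filter fun i => CrossesCut A (e i)).card ≤ 2 * (3 * k)) ?_
  · have h16 : ((1 / 4 : ℝ) ^ (2 * (3 * k)))⁻¹ = 16 ^ (3 * k) := by
      rw [pow_mul, ← inv_pow]; norm_num
    rw [← le_mul_inv_iff₀ (by positivity), h16, mul_pow] at key
    refine key.trans ?_
    have : ((2 / 3 : ℝ)) ^ (11 * (3 * k)) * 16 ^ (3 * k) ≤ (1 / 4) ^ (3 * k) := by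
      rw [pow_mul, ← mul_pow]
      exact pow_le_pow_left₀ (by norm_num) (by norm_num) _
    calc _ = ((2 / 3 : ℝ)) ^ (11 * (3 * k)) * 16 ^ (3 * k) *
          ((3 * k : ℝ) ^ 2) ^ (11 * (3 * k)) := by ring
      _ ≤ _ := mul_le_mul_of_nonneg_right this (by positivity)
  · rw [sum_ite_eq_card, Fintype.card_prod, hV]
    have hc := card_crossesCut A
    have hs : (Finset.univ \ A).card = 3 * k - A.card := by
      rw [Finset.card_sdiff_of_subset (Finset.subset_univ _), Finset.card_univ, hV]
    -- With sides k + b and k + c where b + c = k, the product is 2k² + bc ≥ 2k².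
    obtain ⟨b, hb⟩ : ∃ b, A.card = k + b := ⟨A.card - k, by omega⟩
    obtain ⟨c, hc'⟩ : ∃ c, k = b + c := ⟨k - b, by omega⟩
    have hs' : (Finset.univ \ A).card = k + c := by omega
    rw [hb, hs'] at hc
    have : 4 * k ^ 2 ≤ 2 * ((k + b) * (k + c)) := by subst hc'; nlinarith
    have hR : (4 * k ^ 2 : ℝ) ≤
      ((Finset.univ.filter fun p : V × V => CrossesCut A p).card : ℝ) := by
      exact_mod_cast this.trans hc
    push_cast
    nlinarith
  · intro e he
    rw [prod_ite_eq_pow_card]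
    exact pow_le_pow_of_le_one (by norm_num) (by norm_num) (Finset.mem_filter.1 he).2

/-- Same method, with n = 3k: a random pair touches H with probability at most 2^(-13), so weight
2^13 on touching pairs gives mean at most 2, and Markov's inequality gives 2^(11n) / 2^(13n) =
4^(-n). -/
theorem card_many_touching {k : ℕ} (hV : Fintype.card V = 3 * k) (H : Finset V)
    (hH : 2 ^ 14 * H.card ≤ 3 * k) :
    ((Finset.univ.filter fun e : Fin (11 * (3 * k)) → V × V =>
      3 * k ≤ (Finset.univ.filter fun i => Touches H (e i)).card).card : ℝ) ≤
      (1 / 4) ^ (3 * k) * ((3 * k : ℝ) ^ 2) ^ (11 * (3 * k)) := by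
  have key := card_le_prod_mul_le (fun p : V × V => if Touches H p then (2 ^ 13 : ℝ) else 1)
    (fun a => by split_ifs <;> norm_num) (ρ := 2 * (3 * k : ℝ) ^ 2)
    (θ := (2 ^ 13 : ℝ) ^ (3 * k)) ?_ (11 * (3 * k))
    (Finset.univ.filter fun e : Fin (11 * (3 * k)) → V × V =>
      3 * k ≤ (Finset.univ.filter fun i => Touches H (e i)).card) ?_
  · rw [← le_mul_inv_iff₀ (by positivity), mul_pow] at key
    refine key.trans (le_of_eq ?_)
    have : ((2 : ℝ)) ^ (11 * (3 * k)) * ((2 ^ 13 : ℝ) ^ (3 * k))⁻¹ = (1 / 4) ^ (3 * k) := by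
      rw [pow_mul, ← inv_pow, ← mul_pow]; norm_num
    rw [← this]; ring
  · rw [sum_ite_eq_card, Fintype.card_prod, hV]
    have hc := card_touches H
    rw [hV] at hc
    have hc' : ((Finset.univ.filter fun p : V × V => Touches H p).card : ℝ) ≤
        2 * (H.card * (3 * k)) := by exact_mod_cast hc
    have hH' : (2 ^ 14 * H.card : ℝ) ≤ 3 * k := by exact_mod_cast hH
    have : (2 ^ 14 * H.card : ℝ) * (3 * k) ≤ (3 * k) * (3 * k) :=
      mul_le_mul_of_nonneg_right hH' (by positivity)
    have h0 : (0 : ℝ) ≤ ((Finset.univ.filter fun p : V × V => Touches H p).card : ℝ) := by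
      positivity
    push_cast
    nlinarith
  · intro e he
    rw [prod_ite_eq_pow_card]
    exact pow_le_pow_right₀ (by norm_num) (Finset.mem_filter.1 he).2

/-- Union bound: with n = 3k, the 2^n vertex sets carry two bad events each, of probability at most
4^(-n), and 2 · 2^(-n) < 1. -/
theorem exists_edge_list {k : ℕ} (hk : 0 < k) (hV : Fintype.card V = 3 * k) :
    ∃ e : Fin (11 * (3 * k)) → V × V,
      (∀ A : Finset V, k ≤ A.card → A.card ≤ 2 * k →
        2 * (3 * k) < (Finset.univ.filter fun i => CrossesCut A (e i)).card) ∧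
      (∀ H : Finset V, 2 ^ 14 * H.card ≤ 3 * k →
        (Finset.univ.filter fun i => Touches H (e i)).card < 3 * k) := by
  by_contra hcon
  set q : ℝ := (1 / 4) ^ (3 * k) * ((3 * k : ℝ) ^ 2) ^ (11 * (3 * k)) with hq
  let B₁ : Finset V → Finset (Fin (11 * (3 * k)) → V × V) := fun A =>
    if k ≤ A.card ∧ A.card ≤ 2 * k then Finset.univ.filter fun e =>
      (Finset.univ.filter fun i => CrossesCut A (e i)).card ≤ 2 * (3 * k) else ∅
  let B₂ : Finset V → Finset (Fin (11 * (3 * k)) → V × V) := fun H =>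
    if 2 ^ 14 * H.card ≤ 3 * k then Finset.univ.filter fun e =>
      3 * k ≤ (Finset.univ.filter fun i => Touches H (e i)).card else ∅
  have hB : ∀ A, ((B₁ A ∪ B₂ A).card : ℝ) ≤ 2 * q := by
    intro A
    have h1 : ((B₁ A).card : ℝ) ≤ q := by
      by_cases h : k ≤ A.card ∧ A.card ≤ 2 * k
      · simp only [B₁, if_pos h]
        exact card_few_crossing hV A h.1 h.2
      · simp only [B₁, if_neg h, Finset.card_empty, Nat.cast_zero]; positivity
    have h2 : ((B₂ A).card : ℝ) ≤ q := by
      by_cases h : 2 ^ 14 * A.card ≤ 3 * k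
      · simp only [B₂, if_pos h]
        exact card_many_touching hV A h
      · simp only [B₂, if_neg h, Finset.card_empty, Nat.cast_zero]; positivity
    have h3 : ((B₁ A ∪ B₂ A).card : ℝ) ≤ (B₁ A).card + (B₂ A).card := by
      exact_mod_cast Finset.card_union_le _ _
    linarith
  have hU : (Finset.univ : Finset (Fin (11 * (3 * k)) → V × V)) ⊆
      (Finset.univ : Finset (Finset V)).biUnion fun A => B₁ A ∪ B₂ A := by
    intro e _
    rw [Finset.mem_biUnion]
    by_contra hne
    refine hcon ⟨e, fun A h1 h2 => ?_, fun H hH => ?_⟩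
    · by_contra h
      refine hne ⟨A, Finset.mem_univ _, Finset.mem_union_left _ ?_⟩
      simp only [B₁, if_pos (And.intro h1 h2)]
      simpa using h
    · by_contra h
      refine hne ⟨H, Finset.mem_univ _, Finset.mem_union_right _ ?_⟩
      simp only [B₂, if_pos hH]
      simpa using h
  have hcard : (((Finset.univ : Finset (Fin (11 * (3 * k)) → V × V)).card : ℕ) : ℝ) ≤
      2 ^ (3 * k) * (2 * q) := by
    calc _ ≤ ((∑ A : Finset V, (B₁ A ∪ B₂ A).card : ℕ) : ℝ) := by
          exact_mod_cast (Finset.card_le_card hU).trans Finset.card_biUnion_le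
      _ = ∑ A : Finset V, ((B₁ A ∪ B₂ A).card : ℝ) := by push_cast; rfl
      _ ≤ ∑ _A : Finset V, 2 * q := Finset.sum_le_sum fun A _ => hB A
      _ = _ := by simp [hV]
  have hk' : (0 : ℝ) < k := by exact_mod_cast hk
  have hW : (0 : ℝ) < ((3 * k : ℝ) ^ 2) ^ (11 * (3 * k)) := by positivity
  have hc2 : (((Finset.univ : Finset (Fin (11 * (3 * k)) → V × V)).card : ℕ) : ℝ) =
      ((3 * k : ℝ) ^ 2) ^ (11 * (3 * k)) := by
    rw [Finset.card_univ, Fintype.card_fun, Fintype.card_prod, hV, Fintype.card_fin]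
    push_cast; ring
  rw [hc2, hq] at hcard
  have h2 : (2 : ℝ) ^ (3 * k) * (2 * ((1 / 4) ^ (3 * k) * ((3 * k : ℝ) ^ 2) ^ (11 * (3 * k)))) =
      (2 * (1 / 2) ^ (3 * k)) * ((3 * k : ℝ) ^ 2) ^ (11 * (3 * k)) := by
    have : ((1 : ℝ) / 2) ^ (3 * k) = 2 ^ (3 * k) * (1 / 4) ^ (3 * k) := by
      rw [← mul_pow]; norm_num
    rw [this]; ring
  rw [h2] at hcard
  have h3 : (2 : ℝ) * (1 / 2) ^ (3 * k) ≤ 2 * (1 / 2) ^ 2 := by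
    have := pow_le_pow_of_le_one (by norm_num : (0 : ℝ) ≤ 1 / 2) (by norm_num)
      (show 2 ≤ 3 * k by omega)
    linarith
  nlinarith

/-- Existence of bounded-degree (multi)graphs in which every balanced cut is crossed by linearly
many edges. -/
theorem exists_expander : ∃ d K : ℕ, 0 < d ∧ 0 < K ∧ ∀ k : ℕ, 0 < k →
    ∃ (E : Type) (_ : Fintype E) (e : E → Fin (3 * k) × Fin (3 * k)),
      Fintype.card E ≤ K * k ∧ (∀ i, (e i).1 ≠ (e i).2) ∧
      (∀ v, (Finset.univ.filter fun i => (e i).1 = v ∨ (e i).2 = v).card ≤ d) ∧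
      ∀ A : Finset (Fin (3 * k)), k ≤ A.card → A.card ≤ 2 * k →
        k ≤ (Finset.univ.filter fun i => CrossesCut A (e i)).card := by
  -- The degrees sum to at most 22 · 3k, so at most a 2^(-14) fraction of the vertices can exceed
  -- this threshold.
  obtain ⟨d, hd⟩ : ∃ d, d = 22 * 2 ^ 14 := ⟨_, rfl⟩
  refine ⟨d, 33, by omega, by norm_num, fun k hk => ?_⟩
  obtain ⟨e, he1, he2⟩ := exists_edge_list (V := Fin (3 * k)) hk (by simp)
  let deg : Fin (3 * k) → ℕ := fun v =>
    (Finset.univ.filter fun i => (e i).1 = v ∨ (e i).2 = v).card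
  let H : Finset (Fin (3 * k)) := Finset.univ.filter fun v => d < deg v
  have hsum : ∑ v, deg v ≤ 2 * (11 * (3 * k)) := by
    have h : ∀ v, deg v ≤ ∑ i, ((if (e i).1 = v then 1 else 0) + (if (e i).2 = v then 1 else 0)) := by
      intro v
      simp only [deg, Finset.card_filter]
      refine Finset.sum_le_sum fun i _ => ?_
      by_cases h1 : (e i).1 = v <;> by_cases h2 : (e i).2 = v <;> simp [h1, h2]
    refine (Finset.sum_le_sum fun v _ => h v).trans ?_
    rw [Finset.sum_comm]
    simp [Finset.sum_add_distrib]
    omega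
  have hH : 2 ^ 14 * H.card ≤ 3 * k := by
    have h1 : H.card * d ≤ ∑ v ∈ H, deg v := by
      rw [← smul_eq_mul]
      exact Finset.card_nsmul_le_sum _ _ _ fun v hv => (Finset.mem_filter.1 hv).2.le
    have h2 : ∑ v ∈ H, deg v ≤ ∑ v, deg v :=
      Finset.sum_le_sum_of_subset (Finset.subset_univ _)
    rw [hd] at h1
    omega
  -- The edges that are kept. Of more than 6k edges across a balanced cut, fewer than 3k touch H and
  -- are lost.
  let P : Fin (11 * (3 * k)) → Prop := fun i => (e i).1 ≠ (e i).2 ∧ ¬ Touches H (e i)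
  have hmap : ∀ Q : Fin (11 * (3 * k)) → Prop,
      (Finset.univ.filter fun i : {i // P i} => Q i.1).card =
        (Finset.univ.filter fun i => P i ∧ Q i).card := by
    intro Q
    rw [← Finset.card_map (Function.Embedding.subtype P)]
    congr 1
    ext i
    simp [and_comm]
  refine ⟨{i // P i}, inferInstance, fun i => e i.1, ?_, fun i => i.2.1, fun v => ?_, ?_⟩
  · refine (Fintype.card_subtype_le _).trans ?_
    simp; omega
  · by_cases hv : v ∈ H
    · rw [Finset.card_eq_zero.2]
      · omega
      · rw [Finset.filter_eq_empty_iff]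
        rintro ⟨i, hi⟩ - h
        refine hi.2 ?_
        rcases h with h | h
        · exact Or.inl (h ▸ hv)
        · exact Or.inr (h ▸ hv)
    · have hdeg : deg v ≤ d := by simpa [H] using hv
      refine le_trans (b := (Finset.univ.filter fun i =>
        P i ∧ ((e i).1 = v ∨ (e i).2 = v)).card) (le_of_eq ?_) ((Finset.card_le_card ?_).trans hdeg)
      · convert hmap fun i => (e i).1 = v ∨ (e i).2 = v
      intro i hi
      simp only [Finset.mem_filter, Finset.mem_univ, true_and] at hi ⊢
      exact hi.2
  · intro A h1 h2
    rw [hmap fun i => CrossesCut A (e i)]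
    have hsub : (Finset.univ.filter fun i => CrossesCut A (e i)) ⊆
        (Finset.univ.filter fun i => P i ∧ CrossesCut A (e i)) ∪
        (Finset.univ.filter fun i => Touches H (e i)) := by
      intro i hi
      simp only [Finset.mem_filter, Finset.mem_univ, true_and, Finset.mem_union] at hi ⊢
      by_cases ht : Touches H (e i)
      · exact Or.inr ht
      -- A loop crosses no cut, so deleting loops costs nothing here.
      · refine Or.inl ⟨⟨fun h => hi ?_, ht⟩, hi⟩
        rw [h]
    have h3 := (Finset.card_le_card hsub).trans (Finset.card_union_le _ _)
    have h4 := he1 A h1 h2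
    have h5 := he2 H hH
    omega

end Counting

/-! ### Covering the models of a DNNF by balanced rectangles -/

namespace NNF

variable {X : Type*}

theorem wellFounded_wire (C : NNF X) : WellFounded C.Wire := by
  have : IsTrans C.Gate (Relation.TransGen C.Wire) := ⟨fun _ _ _ => Relation.TransGen.trans⟩
  have : Std.Irrefl (Relation.TransGen C.Wire) := ⟨C.acyclic⟩
  exact Subrelation.wf (fun h => Relation.TransGen.single h)
    (Finite.wellFounded_of_trans_of_irrefl (Relation.TransGen C.Wire))

theorem subVars_mono (C : NNF X) {u v : C.Gate} (h : C.Wire u v) :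
    C.subVars u ⊆ C.subVars v := by
  rintro x ⟨w, b, hw, hl⟩
  exact ⟨w, b, hw.tail h, hl⟩

theorem exists_wire_of_mem_subVars (C : NNF X) {v : C.Gate} {x : X} (hx : x ∈ C.subVars v)
    (hv : ¬ (C.label v).IsInput) : ∃ u, C.Wire u v ∧ x ∈ C.subVars u := by
  obtain ⟨w, b, hw, hl⟩ := hx
  rcases Relation.ReflTransGen.cases_tail hw with h | ⟨u, hwu, huv⟩
  · subst h
    exact absurd (by rw [hl]; trivial) hv
  · exact ⟨u, huv, w, b, hwu, hl⟩

/-- The value of a gate depends only on the variables of its subcircuit. -/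
theorem Holds.congr {C : NNF X} {f g : X → Bool} {v : C.Gate} (h : C.Holds f v)
    (hfg : ∀ x ∈ C.subVars v, f x = g x) : C.Holds g v := by
  induction h with
  | const h => exact .const h
  | @lit v x b h hf => exact .lit h (by rw [← hf, hfg x ⟨v, b, .refl, h⟩])
  | and h _ ih => exact .and h fun u hu => ih u hu fun x hx => hfg x (C.subVars_mono hu hx)
  | or h w _ ih => exact .or h w (ih fun x hx => hfg x (C.subVars_mono w hx))

/-- `C.Context f v`: there is a directed path from `v` to the output of `C` such that the value of
the output is `1` under `f` as soon as the value of `v` is, because all the other inputs of the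
`∧`-gates on the path have value `1`. -/
inductive Context (C : NNF X) (f : X → Bool) : C.Gate → Prop
  | out : Context C f C.out
  | or {u v : C.Gate} (hc : Context C f v) (h : C.label v = .or) (w : C.Wire u v) : Context C f u
  | and {u v : C.Gate} (hc : Context C f v) (h : C.label v = .and) (w : C.Wire u v)
      (hu : ∀ u', C.Wire u' v → u' ≠ u → C.Holds f u') : Context C f u

theorem Context.sat {C : NNF X} {f : X → Bool} {v : C.Gate} (h : C.Context f v)
    (hv : C.Holds f v) : C.Sat f := by
  induction h with
  | out => exact hv
  | or _ h w ih => exact ih (.or h w hv)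
  | @and u v _ h w hu ih =>
    refine ih (.and h fun u' w' => ?_)
    by_cases huu : u' = u
    · exact huu ▸ hv
    · exact hu u' w' huu

/-- In a DNNF, the context of a gate does not depend on the variables of its subcircuit. -/
theorem Context.congr {C : NNF X} (hC : C.IsDNNF) {f g : X → Bool} {v : C.Gate}
    (h : C.Context f v) (hfg : ∀ x ∉ C.subVars v, f x = g x) : C.Context g v := by
  induction h with
  | out => exact .out
  | or _ h w ih => exact .or (ih fun x hx => hfg x fun hx' => hx (C.subVars_mono w hx')) h w
  | and _ h w hu ih =>
    refine .and (ih fun x hx => hfg x fun hx' => hx (C.subVars_mono w hx')) h w ?_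
    intro u' w' hne
    -- Decomposability: a sibling of the gate shares no variable with it, so it keeps its value.
    exact (hu u' w' hne).congr fun x hx =>
      hfg x (Set.disjoint_left.1 (hC _ h _ _ w' w hne) hx)

open Classical

/-- The number of variables from `Y` in the subcircuit sinked at `v`. -/
noncomputable def weight (C : NNF X) (Y : Finset X) (v : C.Gate) : ℕ :=
  (Y.filter (· ∈ C.subVars v)).card

/-- The assignment equal to `f` on `Z` and to `g` outside `Z`. -/
noncomputable def mix (Z : Set X) (f g : X → Bool) : X → Bool := fun x => if x ∈ Z then f x else g x

theorem mix_of_mem {Z : Set X} {f g : X → Bool} {x : X} (h : x ∈ Z) : mix Z f g x = f x := if_pos h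

theorem mix_of_notMem {Z : Set X} {f g : X → Bool} {x : X} (h : x ∉ Z) : mix Z f g x = g x :=
  if_neg h

/-- `R` is contained in a rectangle of satisfying assignments of `C`, with respect to a partition
of the variables that is balanced on `Y`. -/
def IsBalancedRect (C : NNF X) (Y : Finset X) (k : ℕ) (R : Set (X → Bool)) : Prop :=
  ∃ Z : Set X, k ≤ (Y.filter (· ∈ Z)).card ∧ (Y.filter (· ∈ Z)).card ≤ 2 * k ∧
    ∀ f ∈ R, ∀ g ∈ R, C.Sat (mix Z f g)

/-- The satisfying assignments that pass through an `∨`-gate along a wire where the weight drops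
below `2 * k`. -/
def orRect (C : NNF X) (Y : Finset X) (k : ℕ) (v u : C.Gate) : Set (X → Bool) :=
  {f | C.Context f u ∧ 2 * k < C.weight Y u ∧ C.label u = .or ∧ C.Wire v u ∧ C.Holds f v ∧
    C.weight Y v ≤ 2 * k}

/-- The satisfying assignments that pass through an `∧`-gate below which the weight drops
below `2 * k`. -/
def andRect (C : NNF X) (Y : Finset X) (k : ℕ) (u : C.Gate) : Set (X → Bool) :=
  {f | C.Context f u ∧ 2 * k < C.weight Y u ∧ C.label u = .and ∧ C.Holds f u ∧
    ∀ v, C.Wire v u → C.weight Y v ≤ 2 * k}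

theorem exists_intermediate_set (Y : Finset X) (k : ℕ) {A B : Set X} (hAB : A ⊆ B)
    (hA : (Y.filter (· ∈ A)).card ≤ 2 * k) (hB : 2 * k ≤ (Y.filter (· ∈ B)).card) :
    ∃ Z, A ⊆ Z ∧ Z ⊆ B ∧ (Y.filter (· ∈ Z)).card = 2 * k := by
  obtain ⟨T, hT1, hT2, hT3⟩ := Finset.exists_subsuperset_card_eq
    (Finset.monotone_filter_right Y (fun x _ (hx : x ∈ A) => hAB hx)) hA hB
  refine ⟨A ∪ T, Set.subset_union_left, Set.union_subset hAB fun x hx =>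
    (Finset.mem_filter.1 (hT2 hx)).2, ?_⟩
  rw [← hT3]
  congr 1
  ext x
  simp only [Finset.mem_filter, Set.mem_union, Finset.mem_coe]
  constructor
  · rintro ⟨hY, h | h⟩
    · exact hT1 (Finset.mem_filter.2 ⟨hY, h⟩)
    · exact h
  · exact fun h => ⟨(Finset.mem_filter.1 (hT2 h)).1, Or.inr h⟩

/-- Any Z between the variables of `v` and those of `u` works: the value of `v` is read from f
inside Z, and the context of `u` from g outside Z. As the weight passes `2 * k` between the two
gates, Z can be given weight exactly `2 * k`. -/
theorem isBalancedRect_orRect {C : NNF X} (hC : C.IsDNNF) (Y : Finset X) (k : ℕ) (v u : C.Gate)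
    (hne : (C.orRect Y k v u).Nonempty) : C.IsBalancedRect Y k (C.orRect Y k v u) := by
  obtain ⟨f₀, -, h2, h3, h4, -, h6⟩ := hne
  obtain ⟨Z, hZ1, hZ2, hZ3⟩ := exists_intermediate_set Y k (C.subVars_mono h4) h6 h2.le
  refine ⟨Z, by omega, by omega, fun f hf g hg => ?_⟩
  have hctx : C.Context (mix Z f g) u :=
    hg.1.congr hC fun x hx => (mix_of_notMem fun h => hx (hZ2 h)).symm
  have hv : C.Holds (mix Z f g) v :=
    hf.2.2.2.2.1.congr fun x hx => (mix_of_mem (hZ1 hx)).symm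
  exact hctx.sat (.or h3 h4 hv)

/-- A monotone subadditive set function with values at most `2 * k` on singletons takes a
value between `k` and `2 * k`. -/
theorem exists_subset_balanced {α : Type*} (c : Finset α → ℕ) (k : ℕ) (hk : 0 < k)
    (h0 : c ∅ = 0) (hadd : ∀ S a, c (insert a S) ≤ c S + c {a}) (h1 : ∀ a, c {a} ≤ 2 * k)
    (W : Finset α) (hW : k ≤ c W) : ∃ S, k ≤ c S ∧ c S ≤ 2 * k := by
  induction W using Finset.induction_on with
  | empty => omega
  | insert a S _ ih =>
    by_cases hS : k ≤ c S
    · exact ih hS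
    by_cases ha : k ≤ c {a}
    · exact ⟨{a}, ha, h1 a⟩
    exact ⟨_, hW, (hadd S a).trans (by omega)⟩

/-- The variables of the subcircuits sinked at the gates of `S`. -/
def unionVars (C : NNF X) {u : C.Gate} (S : Finset {v // C.Wire v u}) : Set X :=
  {x | ∃ v ∈ S, x ∈ C.subVars v.1}

theorem mem_unionVars {C : NNF X} {u : C.Gate} {S : Finset {v // C.Wire v u}} {x : X} :
    x ∈ C.unionVars S ↔ ∃ v ∈ S, x ∈ C.subVars v.1 := Iff.rfl

/-- All children are light but together heavy, so some set S of children has union of weight between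
`k` and `2 * k`. Children in S take their values from f; by decomposability the other children, and
the context of `u`, take theirs from g. -/
theorem isBalancedRect_andRect {C : NNF X} (hC : C.IsDNNF) (Y : Finset X) (k : ℕ) (hk : 0 < k)
    (u : C.Gate) (hne : (C.andRect Y k u).Nonempty) :
    C.IsBalancedRect Y k (C.andRect Y k u) := by
  obtain ⟨f₀, -, h2, h3, -, h5⟩ := hne
  have : Fintype C.Gate := Fintype.ofFinite _
  obtain ⟨S, hS1, hS2⟩ := exists_subset_balanced
    (fun S : Finset {v // C.Wire v u} => (Y.filter (· ∈ C.unionVars S)).card) k hk (by simp [mem_unionVars])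
    (fun S a => by
      refine le_trans (Finset.card_le_card ?_) (Finset.card_union_le _ _)
      intro x hx
      simp only [Finset.mem_filter, Finset.mem_union, mem_unionVars, Finset.mem_insert,
        Finset.mem_singleton, exists_eq_left, exists_eq_or_imp] at hx ⊢
      exact (and_or_left.1 hx).symm)
    (fun a => by
      simp only [mem_unionVars, Finset.mem_singleton, exists_eq_left]
      exact h5 a.1 a.2) Finset.univ
    (by
      refine le_trans (by omega : k ≤ C.weight Y u) (Finset.card_le_card ?_)
      intro x hx
      rw [Finset.mem_filter] at hx ⊢
      obtain ⟨v, hv, hxv⟩ := C.exists_wire_of_mem_subVars hx.2 (by rw [h3]; exact id)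
      exact ⟨hx.1, ⟨v, hv⟩, Finset.mem_univ _, hxv⟩)
  refine ⟨C.unionVars S, hS1, hS2, fun f hf g hg => ?_⟩
  have hctx : C.Context (mix (C.unionVars S) f g) u := by
    refine hg.1.congr hC fun x hx => (mix_of_notMem ?_).symm
    rintro ⟨v, -, hv⟩
    exact hx (C.subVars_mono v.2 hv)
  refine hctx.sat (.and h3 fun v hv => ?_)
  by_cases hvS : (⟨v, hv⟩ : {v // C.Wire v u}) ∈ S
  · exact ((C.holds_and f h3).1 hf.2.2.2.1 v hv).congr fun x hx =>
      (mix_of_mem (mem_unionVars.2 ⟨_, hvS, hx⟩)).symm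
  · refine ((C.holds_and g h3).1 hg.2.2.2.1 v hv).congr fun x hx => (mix_of_notMem ?_).symm
    rintro ⟨⟨v', hv'⟩, hS', hx'⟩
    refine Set.disjoint_left.1 (hC u h3 v v' hv hv' ?_) hx hx'
    rintro rfl
    exact hvS hS'

theorem weight_le_one_of_isInput (C : NNF X) (Y : Finset X) {v : C.Gate}
    (hv : (C.label v).IsInput) : C.weight Y v ≤ 1 := by
  have key : ∀ x ∈ C.subVars v, ∃ b, C.label v = .lit x b := by
    rintro x ⟨w, b, hw, hl⟩
    rcases Relation.ReflTransGen.cases_tail hw with h | ⟨u, -, huv⟩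
    · exact ⟨b, h ▸ hl⟩
    · exact absurd huv ((C.source_iff v).2 hv u)
  rw [weight, Finset.card_le_one]
  intro x hx y hy
  obtain ⟨b, hb⟩ := key x (Finset.mem_filter.1 hx).2
  obtain ⟨b', hb'⟩ := key y (Finset.mem_filter.1 hy).2
  rw [hb] at hb'
  exact (GateLabel.lit.inj hb').1

/-- Take a lowest gate that is heavy, true under f and has a context under f. A true child of an
∨-gate, or any child of a true ∧-gate, inherits the last two properties, so by minimality it is
light. -/
theorem sat_mem_rect (C : NNF X) (Y : Finset X) (k : ℕ) (hk : 0 < k) {f : X → Bool}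
    (hf : C.Sat f) (hout : 2 * k < C.weight Y C.out) :
    ∃ v u, C.Wire v u ∧ (f ∈ C.orRect Y k v u ∨ f ∈ C.andRect Y k u) := by
  obtain ⟨u, ⟨hu1, hu2, hu3⟩, hmin⟩ := C.wellFounded_wire.has_min
    {u | C.Context f u ∧ C.Holds f u ∧ 2 * k < C.weight Y u} ⟨C.out, .out, hf, hout⟩
  have hin : ¬ (C.label u).IsInput := fun h => by
    have := C.weight_le_one_of_isInput Y h
    omega
  cases hl : C.label u with
  | const b => exact absurd (by rw [hl]; trivial) hin
  | lit x b => exact absurd (by rw [hl]; trivial) hin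
  | or =>
    obtain ⟨v, w, hv⟩ := (C.holds_or f hl).1 hu2
    refine ⟨v, u, w, Or.inl ⟨hu1, hu3, hl, w, hv, ?_⟩⟩
    by_contra hlt
    exact hmin v ⟨hu1.or hl w, hv, not_le.1 hlt⟩ w
  | and =>
    have hch := (C.holds_and f hl).1 hu2
    -- The child itself is irrelevant: it only supplies a wire, because the rectangles are indexed
    -- by wires.
    obtain ⟨v, w⟩ : ∃ v, C.Wire v u := by
      by_contra h
      exact hin ((C.source_iff u).1 (not_exists.1 h))
    refine ⟨v, u, w, Or.inr ⟨hu1, hu3, hl, hu2, fun v' w' => ?_⟩⟩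
    by_contra hlt
    exact hmin v' ⟨hu1.and hl w' fun u' hu' _ => hch u' hu', hch v' w', not_le.1 hlt⟩ w'

/-- The satisfying assignments of a DNNF are covered by at most `size + 1` balanced rectangles. -/
theorem exists_balanced_rect_cover {C : NNF X} (hC : C.IsDNNF) (Y : Finset X) (k : ℕ)
    (hk : 0 < k) (hY : Y.card = 3 * k) :
    ∃ (ι : Type) (_ : Fintype ι) (R : ι → Set (X → Bool)), Fintype.card ι ≤ C.size + 1 ∧
      (∀ i, (R i).Nonempty → C.IsBalancedRect Y k (R i)) ∧
      ∀ f, C.Sat f → ∃ i, f ∈ R i := by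
  have : Fintype C.Gate := Fintype.ofFinite _
  by_cases hout : 2 * k < C.weight Y C.out
  · let P := {p : C.Gate × C.Gate // C.Wire p.1 p.2}
    let R : P → Set (X → Bool) := fun p =>
      if C.label p.1.2 = .or then C.orRect Y k p.1.1 p.1.2 else C.andRect Y k p.1.2
    refine ⟨P, inferInstance, R, ?_, ?_, ?_⟩
    · rw [← Nat.card_eq_fintype_card]
      exact Nat.le_succ _
    · intro p
      by_cases h : C.label p.1.2 = .or
      · simp only [R, if_pos h]
        exact isBalancedRect_orRect hC Y k _ _
      · simp only [R, if_neg h]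
        exact isBalancedRect_andRect hC Y k hk _
    · intro f hf
      obtain ⟨v, u, w, h⟩ := C.sat_mem_rect Y k hk hf hout
      refine ⟨⟨(v, u), w⟩, ?_⟩
      rcases h with h | h
      · simp only [R, if_pos h.2.2.1]
        exact h
      · have hl : C.label u ≠ .or := by rw [h.2.2.1]; simp
        simp only [R, if_neg hl]
        exact h
  -- If the output itself is light, a single rectangle suffices: Z contains all variables of the
  -- circuit, so the mixture agrees with f on them. This case accounts for the `+ 1`, since there
  -- may be no wires at all.
  · refine ⟨Unit, inferInstance, fun _ => {f | C.Sat f}, by simp, fun _ _ => ?_,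
      fun f hf => ⟨(), hf⟩⟩
    obtain ⟨Z, hZ1, -, hZ3⟩ := exists_intermediate_set Y k (Set.subset_univ (C.subVars C.out))
      (not_lt.1 hout) (by simp; omega)
    exact ⟨Z, by omega, by omega, fun f hf g _ =>
      Holds.congr hf fun x hx => (mix_of_mem (hZ1 hx)).symm⟩

end NNF

/-! ### Counting vertex covers that contain a prescribed set -/

section VertexCovers

open Classical

variable {V E : Type} [Fintype E]

/-- The vertex covers of the multigraph with edges `e` that contain `F`. -/
noncomputable def coversContaining [Fintype V] (e : E → V × V) (F : Finset V) : Finset (Finset V) :=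
  Finset.univ.filter fun s => (∀ i, (e i).1 ∈ s ∨ (e i).2 ∈ s) ∧ F ⊆ s

theorem mem_coversContaining [Fintype V] {e : E → V × V} {F s : Finset V} :
    s ∈ coversContaining e F ↔ (∀ i, (e i).1 ∈ s ∨ (e i).2 ∈ s) ∧ F ⊆ s := by
  simp [coversContaining]

/-- The edges incident with `v`. -/
noncomputable def incidentEdges (e : E → V × V) (v : V) : Finset E :=
  Finset.univ.filter fun i => (e i).1 = v ∨ (e i).2 = v

theorem mem_incidentEdges {e : E → V × V} {v : V} {i : E} :
    i ∈ incidentEdges e v ↔ (e i).1 = v ∨ (e i).2 = v := by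
  simp [incidentEdges]

/-- The neighbours of `v`. -/
noncomputable def neighbors (e : E → V × V) (v : V) : Finset V :=
  (incidentEdges e v).image fun i => if (e i).1 = v then (e i).2 else (e i).1

theorem snd_mem_neighbors {e : E → V × V} {v : V} {i : E} (h : (e i).1 = v) :
    (e i).2 ∈ neighbors e v :=
  Finset.mem_image.2 ⟨i, mem_incidentEdges.2 (Or.inl h), by simp [h]⟩

theorem fst_mem_neighbors {e : E → V × V} (hloop : ∀ i, (e i).1 ≠ (e i).2) {v : V} {i : E}
    (h : (e i).2 = v) : (e i).1 ∈ neighbors e v :=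
  Finset.mem_image.2 ⟨i, mem_incidentEdges.2 (Or.inr h), if_neg fun h' => hloop i (h'.trans h.symm)⟩

theorem notMem_neighbors {e : E → V × V} (hloop : ∀ i, (e i).1 ≠ (e i).2) (v : V) :
    v ∉ neighbors e v := by
  intro hv
  obtain ⟨i, -, h⟩ := Finset.mem_image.1 hv
  split_ifs at h with h1
  · exact hloop i (h1.trans h.symm)
  · exact h1 h

/-- A cover containing v becomes one avoiding v when v is exchanged for all its neighbours N;
recording s ∩ N makes this injective. So covers with v are at most 2^d times as many as covers
without v. -/
theorem card_coversContaining_insert [Fintype V] {e : E → V × V} (hloop : ∀ i, (e i).1 ≠ (e i).2) {d : ℕ}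
    {v : V} (hdeg : (incidentEdges e v).card ≤ d) {F : Finset V} (hv : v ∉ F) :
    (2 ^ d + 1) * (coversContaining e (insert v F)).card ≤
      2 ^ d * (coversContaining e F).card := by
  set N := neighbors e v with hN
  have hNd : N.card ≤ d := Finset.card_image_le.trans hdeg
  have hvN : v ∉ N := notMem_neighbors hloop v
  set T := (coversContaining e F).filter fun s => v ∉ s with hT
  have hsplit : (coversContaining e (insert v F)).card + T.card = (coversContaining e F).card := by
    rw [← Finset.card_filter_add_card_filter_not (s := coversContaining e F) (fun s => v ∈ s)]
    congr 2
    ext s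
    simp only [Finset.mem_filter, mem_coversContaining, Finset.insert_subset_iff]
    tauto
  have hinj : (coversContaining e (insert v F)).card ≤ (T ×ˢ N.powerset).card := by
    refine Finset.card_le_card_of_injOn (fun s => ((s ∪ N).erase v, s ∩ N)) ?_ ?_
    · intro s hs
      obtain ⟨hs1, hs2⟩ := mem_coversContaining.1 hs
      have hF : F ⊆ s := (Finset.subset_insert _ _).trans hs2
      refine Finset.mem_product.2 ⟨Finset.mem_filter.2 ⟨mem_coversContaining.2 ⟨fun i => ?_, ?_⟩,
        Finset.notMem_erase _ _⟩, Finset.mem_powerset.2 Finset.inter_subset_right⟩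
      · by_cases h1 : (e i).1 = v
        · refine Or.inr (Finset.mem_erase.2 ⟨fun h => hloop i (h1.trans h.symm), ?_⟩)
          exact Finset.mem_union_right _ (snd_mem_neighbors h1)
        by_cases h2 : (e i).2 = v
        · exact Or.inl (Finset.mem_erase.2
            ⟨h1, Finset.mem_union_right _ (fst_mem_neighbors hloop h2)⟩)
        · exact (hs1 i).imp (fun h => Finset.mem_erase.2 ⟨h1, Finset.mem_union_left _ h⟩)
            fun h => Finset.mem_erase.2 ⟨h2, Finset.mem_union_left _ h⟩
      · exact fun x hx => Finset.mem_erase.2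
          ⟨fun h => hv (h ▸ hx), Finset.mem_union_left _ (hF hx)⟩
    · intro s hs t ht hst
      have hvs : v ∈ s := (mem_coversContaining.1 hs).2 (Finset.mem_insert_self _ _)
      have hvt : v ∈ t := (mem_coversContaining.1 ht).2 (Finset.mem_insert_self _ _)
      obtain ⟨h1, h2⟩ := Prod.mk.inj hst
      ext x
      by_cases hxv : x = v
      · simp [hxv, hvs, hvt]
      by_cases hxN : x ∈ N
      · have := Finset.ext_iff.1 h2 x
        simpa [hxN] using this
      · have := Finset.ext_iff.1 h1 x
        simpa [hxN, hxv] using this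
  rw [Finset.card_product, Finset.card_powerset] at hinj
  have h2 : T.card * 2 ^ N.card ≤ T.card * 2 ^ d :=
    Nat.mul_le_mul_left _ (Nat.pow_le_pow_right (by norm_num) hNd)
  rw [← hsplit]
  nlinarith

theorem card_coversContaining_mul_pow_le [Fintype V] {e : E → V × V} (hloop : ∀ i, (e i).1 ≠ (e i).2) {d : ℕ}
    (hdeg : ∀ v, (incidentEdges e v).card ≤ d) (F : Finset V) :
    ((coversContaining e F).card : ℝ) * (1 + 1 / 2 ^ d) ^ F.card ≤
      (coversContaining e ∅).card := by
  induction F using Finset.induction_on with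
  | empty => simp
  | insert v F hv ih =>
    refine le_trans ?_ ih
    rw [Finset.card_insert_of_notMem hv, pow_succ', ← mul_assoc]
    refine mul_le_mul_of_nonneg_right ?_ (by positivity)
    have h : ((2 ^ d + 1 : ℝ)) * (coversContaining e (insert v F)).card ≤
        2 ^ d * (coversContaining e F).card := by
      exact_mod_cast card_coversContaining_insert hloop (hdeg v) hv
    have h2 : (0 : ℝ) < 2 ^ d := by positivity
    rw [← mul_le_mul_iff_right₀ h2]
    refine le_trans (le_of_eq ?_) h
    field_simp

/-- An edge set covered by `F` has at most `d * F.card` elements. -/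
theorem card_le_of_forall_covered {e : E → V × V} {d : ℕ}
    (hdeg : ∀ v, (incidentEdges e v).card ≤ d) (F : Finset V) (S : Finset E)
    (hS : ∀ i ∈ S, (e i).1 ∈ F ∨ (e i).2 ∈ F) : S.card ≤ F.card * d := by
  have : S ⊆ F.biUnion (incidentEdges e) := by
    intro i hi
    rw [Finset.mem_biUnion]
    rcases hS i hi with h | h
    · exact ⟨_, h, mem_incidentEdges.2 (Or.inl rfl)⟩
    · exact ⟨_, h, mem_incidentEdges.2 (Or.inr rfl)⟩
  exact (Finset.card_le_card this).trans (Finset.card_biUnion_le_card_mul _ _ _ fun v _ => hdeg v)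

end VertexCovers

/-! ### Exponential lower bound for DNNFs of vertex covers -/

namespace NNF

section LowerBound

open Classical

variable {X : Type*} {V E : Type} [Fintype E]

/-- The assignment sending exactly the variables of the vertices in `s` to `1`. -/
noncomputable def vertexAssignment (x : V ↪ X) (s : Finset V) : X → Bool :=
  fun y => decide (y ∈ s.map x)

theorem vertexAssignment_apply (x : V ↪ X) (s : Finset V) (v : V) :
    vertexAssignment x s (x v) = true ↔ v ∈ s := by
  simp [vertexAssignment]

/-- Double counting: each rectangle contains at most a `(1 + 1 / 2 ^ d) ^ (-k / d)` fraction of the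
vertex covers, and `C.size + 1` rectangles contain all of them. -/
theorem pow_le_size_add_one [Fintype V] {k d : ℕ} (hk : 0 < k) (hd : 0 < d) (hV : Fintype.card V = 3 * k)
    (x : V ↪ X) (e : E → V × V) (hloop : ∀ i, (e i).1 ≠ (e i).2)
    (hdeg : ∀ v, (incidentEdges e v).card ≤ d)
    (hcut : ∀ A : Finset V, k ≤ A.card → A.card ≤ 2 * k →
      k ≤ (Finset.univ.filter fun i => CrossesCut A (e i)).card)
    {C : NNF X} (hC : C.IsDNNF)
    (hsat : ∀ f, C.Sat f ↔ ∀ i, f (x (e i).1) = true ∨ f (x (e i).2) = true) :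
    (1 + 1 / 2 ^ d : ℝ) ^ ((k : ℝ) / d) ≤ C.size + 1 := by
  obtain ⟨ι, _, R, hcard, hbal, hcov⟩ := exists_balanced_rect_cover hC
    ((Finset.univ : Finset V).map x) k hk (by simp [hV])
  set b : ℝ := 1 + 1 / 2 ^ d with hb
  have hb1 : 1 ≤ b := by rw [hb]; simp
  have hb0 : 0 < b := by linarith
  let 𝓜 := coversContaining e ∅
  have hM : ∀ s, s ∈ 𝓜 ↔ C.Sat (vertexAssignment x s) := by
    intro s
    simp [𝓜, mem_coversContaining, hsat, vertexAssignment_apply]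
  let part : ι → Finset (Finset V) := fun j => 𝓜.filter fun s => vertexAssignment x s ∈ R j
  have hpart : ∀ j, ((part j).card : ℝ) * b ^ ((k : ℝ) / d) ≤ 𝓜.card := by
    intro j
    by_cases hne : (part j).Nonempty
    swap
    · rw [Finset.not_nonempty_iff_eq_empty.1 hne]
      simp
    obtain ⟨s₀, hs₀⟩ := hne
    obtain ⟨Z, hZ1, hZ2, hZ⟩ := hbal j ⟨_, (Finset.mem_filter.1 hs₀).2⟩
    -- The vertices forced by the rectangle.
    let F : Finset V := Finset.univ.filter fun v => ∀ s ∈ part j, v ∈ s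
    have hF : ∀ v, v ∉ F → ∃ s, vertexAssignment x s ∈ R j ∧ vertexAssignment x s (x v) = false := by
      intro v hv
      simp only [F, Finset.mem_filter, Finset.mem_univ, true_and, not_forall] at hv
      obtain ⟨s, hs, hvs⟩ := hv
      refine ⟨s, (Finset.mem_filter.1 hs).2, ?_⟩
      rw [← Bool.not_eq_true, vertexAssignment_apply]
      exact hvs
    let A : Finset V := Finset.univ.filter fun v => x v ∈ Z
    have hA : A.card = (((Finset.univ : Finset V).map x).filter (· ∈ Z)).card := by
      rw [Finset.filter_map, Finset.card_map]
      rfl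
    have hmix : ∀ v w, x v ∈ Z → x w ∉ Z → v ∉ F → w ∉ F →
        ∃ f, C.Sat f ∧ f (x v) = false ∧ f (x w) = false := by
      intro v w hv hw hvF hwF
      obtain ⟨s, hs, hs'⟩ := hF v hvF
      obtain ⟨t, ht, ht'⟩ := hF w hwF
      exact ⟨_, hZ _ hs _ ht, (mix_of_mem hv).trans hs', (mix_of_notMem hw).trans ht'⟩
    -- F must meet every edge across the cut, since mixing covers that omit the two endpoints would
    -- yield a model of `C` that leaves the edge uncovered.
    have hcover : k ≤ F.card * d := by
      refine (hcut A (hA ▸ hZ1) (hA ▸ hZ2)).trans (card_le_of_forall_covered hdeg F _ ?_)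
      intro i hi
      by_contra hcon
      rw [not_or] at hcon
      have hcr : ¬ (x (e i).1 ∈ Z ↔ x (e i).2 ∈ Z) := by
        simpa [CrossesCut, A] using (Finset.mem_filter.1 hi).2
      obtain ⟨f, hf, h1, h2⟩ : ∃ f, C.Sat f ∧ f (x (e i).1) = false ∧ f (x (e i).2) = false := by
        by_cases h : x (e i).1 ∈ Z
        · exact hmix _ _ h (fun h' => hcr (iff_of_true h h')) hcon.1 hcon.2
        · obtain ⟨f, hf, h1, h2⟩ := hmix (e i).2 (e i).1
            (by_contra fun h' => hcr (iff_of_false h h')) h hcon.2 hcon.1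
          exact ⟨f, hf, h2, h1⟩
      rcases (hsat f).1 hf i with h | h
      · rw [h1] at h; exact Bool.noConfusion h
      · rw [h2] at h; exact Bool.noConfusion h
    have hsub : part j ⊆ coversContaining e F := by
      intro s hs
      refine mem_coversContaining.2
        ⟨(mem_coversContaining.1 (Finset.mem_filter.1 hs).1).1, fun v hv => ?_⟩
      exact (Finset.mem_filter.1 hv).2 s hs
    have hpow : b ^ ((k : ℝ) / d) ≤ b ^ F.card := by
      rw [← Real.rpow_natCast]
      refine Real.rpow_le_rpow_of_exponent_le hb1 ?_
      rw [div_le_iff₀ (by exact_mod_cast hd)]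
      exact_mod_cast hcover
    calc ((part j).card : ℝ) * b ^ ((k : ℝ) / d)
        ≤ (coversContaining e F).card * b ^ F.card := by
          refine mul_le_mul ?_ hpow (by positivity) (by positivity)
          exact_mod_cast Finset.card_le_card hsub
      _ ≤ _ := card_coversContaining_mul_pow_le hloop hdeg F
  have hM0 : (0 : ℝ) < 𝓜.card := by
    have : Finset.univ ∈ 𝓜 := mem_coversContaining.2 ⟨fun i => by simp, by simp⟩
    exact_mod_cast Finset.card_pos.2 ⟨_, this⟩
  have hunion : (𝓜.card : ℝ) ≤ ∑ j, ((part j).card : ℝ) := by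
    have : 𝓜 ⊆ Finset.univ.biUnion part := by
      intro s hs
      obtain ⟨j, hj⟩ := hcov _ ((hM s).1 hs)
      exact Finset.mem_biUnion.2 ⟨j, Finset.mem_univ _, Finset.mem_filter.2 ⟨hs, hj⟩⟩
    exact_mod_cast (Finset.card_le_card this).trans Finset.card_biUnion_le
  have hfin : (𝓜.card : ℝ) * b ^ ((k : ℝ) / d) ≤ 𝓜.card * (C.size + 1) := by
    calc (𝓜.card : ℝ) * b ^ ((k : ℝ) / d)
        ≤ (∑ j, ((part j).card : ℝ)) * b ^ ((k : ℝ) / d) :=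
          mul_le_mul_of_nonneg_right hunion (by positivity)
      _ = ∑ j, ((part j).card : ℝ) * b ^ ((k : ℝ) / d) := Finset.sum_mul _ _ _
      _ ≤ ∑ _j : ι, (𝓜.card : ℝ) := Finset.sum_le_sum fun j _ => hpart j
      _ = 𝓜.card * Fintype.card ι := by simp [mul_comm]
      _ ≤ _ := by
          refine mul_le_mul_of_nonneg_left ?_ hM0.le
          exact_mod_cast hcard
  exact le_of_mul_le_mul_left hfin hM0

end LowerBound

/-! ### The 2-DNF of a multigraph -/

/-- The gates of the 2-DNF with a term for each element of `E`. -/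
inductive DNFGate (E : Type) : Type where
  | out : DNFGate E
  | term (i : E) : DNFGate E
  | lit (i : E) (b : Bool) : DNFGate E

/-- The wires of the 2-DNF with a term for each element of `E`. -/
inductive DNFWire {E : Type} : DNFGate E → DNFGate E → Prop where
  | term (i : E) : DNFWire (.term i) .out
  | lit (i : E) (b : Bool) : DNFWire (.lit i b) (.term i)

/-- The depth of a gate of a 2-DNF, counted from the literals. -/
def DNFGate.rank {E : Type} : DNFGate E → ℕ
  | .out => 2
  | .term _ => 1
  | .lit _ _ => 0

theorem DNFWire.rank_lt {E : Type} {u v : DNFGate E} (h : DNFWire u v) : u.rank < v.rank := by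
  cases h <;> simp [DNFGate.rank]

instance {E : Type} [Finite E] : Finite (DNFGate E) :=
  Finite.of_surjective
    (fun o : Option (E × Option Bool) => match o with
      | none => DNFGate.out
      | some (i, none) => .term i
      | some (i, some b) => .lit i b)
    (by
      rintro (_ | i | ⟨i, b⟩)
      exacts [⟨none, rfl⟩, ⟨some (i, none), rfl⟩, ⟨some (i, some b), rfl⟩])

variable {X : Type*}

/-- The labels of the 2-DNF `⋁ᵢ (¬ (y i).1 ∧ ¬ (y i).2)`. -/
def dnfLabel {E : Type} (y : E → X × X) : DNFGate E → GateLabel X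
  | .out => .or
  | .term _ => .and
  | .lit i b => .lit (cond b (y i).1 (y i).2) false

/-- The 2-DNF `⋁ᵢ (¬ (y i).1 ∧ ¬ (y i).2)`. -/
def edgeDNF {E : Type} [Finite E] [Nonempty E] (y : E → X × X) : NNF X where
  Gate := DNFGate E
  finite_gate := inferInstance
  Wire := DNFWire
  acyclic v h := by
    have : ∀ w, Relation.TransGen DNFWire v w → v.rank < w.rank := fun w hw => by
      induction hw with
      | single h => exact h.rank_lt
      | tail _ h ih => exact ih.trans h.rank_lt
    exact lt_irrefl _ (this v h)
  label := dnfLabel y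
  source_iff := by
    rintro (_ | i | ⟨i, b⟩)
    · exact iff_of_false (fun h => h _ (.term (Classical.arbitrary E))) id
    · exact iff_of_false (fun h => h _ (.lit i true)) id
    · exact iff_of_true (fun u h => nomatch h) trivial
  out := .out
  sink_iff := by
    rintro (_ | i | ⟨i, b⟩)
    · exact iff_of_true (fun u h => nomatch h) rfl
    · exact iff_of_false (fun h => h _ (.term i)) (fun h => nomatch h)
    · exact iff_of_false (fun h => h _ (.lit i b)) (fun h => nomatch h)

section EdgeDNF

variable {E : Type} [Finite E] [Nonempty E] (y : E → X × X)

theorem edgeDNF_sat (f : X → Bool) :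
    (edgeDNF y).Sat f ↔ ∃ i, f (y i).1 = false ∧ f (y i).2 = false := by
  have hlit : ∀ i b, (edgeDNF y).Holds f (.lit i b) ↔ f (cond b (y i).1 (y i).2) = false :=
    fun i b => holds_lit _ _ rfl
  rw [Sat, holds_or (edgeDNF y) f (v := (edgeDNF y).out) rfl]
  constructor
  · rintro ⟨u, w, hu⟩
    change DNFWire u .out at w
    cases w with
    | term i =>
      have h := (holds_and (edgeDNF y) f (v := .term i) rfl).1 hu
      exact ⟨i, (hlit i true).1 (h _ (.lit i true)), (hlit i false).1 (h _ (.lit i false))⟩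
  · rintro ⟨i, h1, h2⟩
    refine ⟨.term i, .term i, (holds_and (edgeDNF y) f (v := .term i) rfl).2 fun u w => ?_⟩
    change DNFWire u (.term i) at w
    cases w with
    | lit _ b =>
      rw [hlit]
      cases b
      exacts [h2, h1]

theorem edgeDNF_subVars_lit (i : E) (b : Bool) :
    (edgeDNF y).subVars (.lit i b) ⊆ {cond b (y i).1 (y i).2} := by
  rintro x ⟨w, c, hw, hl⟩
  rcases Relation.ReflTransGen.cases_tail hw with h | ⟨u, -, huv⟩
  · subst h
    exact (GateLabel.lit.inj hl).1.symm
  · change DNFWire u (.lit i b) at huv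
    cases huv

/-- Looplessness is what makes the two literals of a term have different variables. -/
theorem edgeDNF_isDNNF (hy : ∀ i, (y i).1 ≠ (y i).2) : (edgeDNF y).IsDNNF := by
  intro v hv u u' w w' hne
  change DNFWire u v at w
  change DNFWire u' v at w'
  cases w with
  | term i => exact nomatch hv
  | lit i b =>
    cases w' with
    | lit _ b' =>
      refine Set.disjoint_of_subset (edgeDNF_subVars_lit y i b) (edgeDNF_subVars_lit y i b') ?_
      rw [Set.disjoint_singleton]
      cases b <;> cases b'
      · exact absurd rfl hne
      · exact (hy i).symm
      · exact hy i
      · exact absurd rfl hne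

theorem edgeDNF_isKDNF : (edgeDNF y).IsKDNF 2 := by
  refine ⟨⟨rfl, ?_, ?_⟩, ?_⟩
  · rintro (_ | i | ⟨i, b⟩) h
    · exact absurd rfl h
    · exact Or.inl rfl
    · exact Or.inr ⟨_, _, rfl⟩
  · intro v hv u w
    change DNFWire u v at w
    cases w with
    | term i => cases hv
    | lit i b => exact ⟨_, _, rfl⟩
  · rintro (_ | i | ⟨i, b⟩) hv
    · cases hv
    · have : Function.Surjective
          (fun b : Bool => (⟨.lit i b, .lit i b⟩ : {u // DNFWire u (.term i)})) := by
        rintro ⟨_, ⟨⟩⟩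
        exact ⟨_, rfl⟩
      have h := Nat.card_le_card_of_surjective _ this
      rw [Nat.card_eq_fintype_card (α := Bool), Fintype.card_bool] at h
      exact h
    · cases hv

theorem edgeDNF_size_le : (edgeDNF y).size ≤ 3 * Nat.card E := by
  let φ : E × Option Bool → {p : DNFGate E × DNFGate E // DNFWire p.1 p.2} := fun q =>
    match q with
    | (i, none) => ⟨(.term i, .out), .term i⟩
    | (i, some b) => ⟨(.lit i b, .term i), .lit i b⟩
  have hφ : Function.Surjective φ := by
    rintro ⟨⟨u, v⟩, w⟩
    change DNFWire u v at w
    cases w with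
    | term i => exact ⟨(i, none), rfl⟩
    | lit i b => exact ⟨(i, some b), rfl⟩
  have h := Nat.card_le_card_of_surjective φ hφ
  rw [Nat.card_prod, Nat.card_eq_fintype_card (α := Option Bool)] at h
  simp only [Fintype.card_option, Fintype.card_bool] at h
  exact h.trans (le_of_eq (by ring))

theorem card_le_edgeDNF_size : Nat.card E ≤ (edgeDNF y).size := by
  refine Nat.card_le_card_of_injective
    (fun i => (⟨(.term i, .out), .term i⟩ : {p : DNFGate E × DNFGate E // DNFWire p.1 p.2})) ?_
  intro i j h
  exact DNFGate.term.inj (Prod.mk.inj (Subtype.mk.inj h)).1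

end EdgeDNF

/-! ### Choice of constants and superpolynomial growth -/

/-- There are arbitrarily large 2-DNFs, which are DNNFs, whose negation requires DNNFs of
exponential size. -/
theorem exists_hard_dnf (X : Type*) [Infinite X] : ∃ c : ℝ, 0 < c ∧ ∀ N : ℕ, ∃ D : NNF X,
    N ≤ D.size ∧ D.IsDNNF ∧ D.IsKDNF 2 ∧
      ∀ D' : NNF X, D'.IsDNNF → D'.EquivNeg D → (2 : ℝ) ^ (c * (D.size : ℝ)) ≤ (D'.size : ℝ) := by
  obtain ⟨d, K, hd, hK, hex⟩ := exists_expander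
  have hd' : (0 : ℝ) < d := by exact_mod_cast hd
  have hK' : (0 : ℝ) < K := by exact_mod_cast hK
  set b : ℝ := 1 + 1 / 2 ^ d with hb
  have hb1 : 1 < b := by rw [hb]; simp
  set a : ℝ := Real.logb 2 b / d with ha
  have ha0 : 0 < a := div_pos (Real.logb_pos (by norm_num) hb1) hd'
  have hba : ∀ k : ℕ, b ^ ((k : ℝ) / d) = 2 ^ (a * k) := by
    intro k
    nth_rewrite 1 [← Real.rpow_logb (b := 2) (x := b) (by norm_num) (by norm_num) (by linarith)]
    rw [← Real.rpow_mul (by norm_num)]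
    congr 1
    rw [ha]; ring
  -- The formula has size at most 3Kk, so this constant uses only half of the exponent ak. The other
  -- half absorbs the `+ 1`: with z = 2^(ak/2) ≥ 2, one has z² - 1 ≥ z. The bound z ≥ 2 is why k is
  -- taken at least 2/a.
  refine ⟨a / (6 * K), by positivity, fun N => ?_⟩
  obtain ⟨k₀, hk₀⟩ := exists_nat_ge (2 / a)
  set k := max (max k₀ N) 1 with hk
  have hk1 : 0 < k := by omega
  have hak : 2 ≤ a * k := by
    have h1 : (k₀ : ℝ) ≤ k := by exact_mod_cast (by omega : k₀ ≤ k)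
    have h2 := (div_le_iff₀ ha0).1 (hk₀.trans h1)
    linarith
  obtain ⟨E, _, e, hcard, hloop, hdeg, hcut⟩ := hex k hk1
  -- Any k vertices form a balanced cut, which already has k edges across it.
  have hkE : k ≤ Fintype.card E := by
    obtain ⟨A, -, hA⟩ := Finset.exists_subset_card_eq
      (s := (Finset.univ : Finset (Fin (3 * k)))) (n := k) (by simp; omega)
    exact (hcut A hA.ge (by omega)).trans (Finset.card_le_univ _)
  have : Nonempty E := Fintype.card_pos_iff.1 (by omega)
  let x : Fin (3 * k) ↪ X := Fin.valEmbedding.trans (Infinite.natEmbedding X)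
  let y : E → X × X := fun i => (x (e i).1, x (e i).2)
  have hsizeN : N ≤ (edgeDNF y).size := by
    have h := card_le_edgeDNF_size y
    rw [Nat.card_eq_fintype_card] at h
    omega
  have hsizeK : (edgeDNF y).size ≤ 3 * (K * k) := by
    have h := edgeDNF_size_le y
    rw [Nat.card_eq_fintype_card] at h
    omega
  refine ⟨edgeDNF y, hsizeN, edgeDNF_isDNNF y fun i h => hloop i (x.injective h),
    edgeDNF_isKDNF y, fun C hC hneg => ?_⟩
  have hlow := pow_le_size_add_one hk1 hd (by simp) x e hloop
    (fun v => by
      refine le_trans (le_of_eq ?_) (hdeg v)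
      congr 1
      ext i
      simp [mem_incidentEdges])
    (fun A h1 h2 => hcut A h1 h2) hC
    (fun f => by
      rw [hneg f, edgeDNF_sat]
      simp only [y, not_exists, not_and_or, Bool.not_eq_false])
  rw [← hb, hba] at hlow
  have hexp : a / (6 * K) * ((edgeDNF y).size : ℝ) ≤ a * k / 2 := by
    have h : ((edgeDNF y).size : ℝ) ≤ 3 * (K * k) := by exact_mod_cast hsizeK
    calc a / (6 * K) * ((edgeDNF y).size : ℝ) ≤ a / (6 * K) * (3 * (K * k)) :=
          mul_le_mul_of_nonneg_left h (by positivity)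
      _ = a * k / 2 := by field_simp; norm_num
  set z : ℝ := 2 ^ (a * k / 2) with hz
  have hz2 : 2 ≤ z := by
    have := Real.rpow_le_rpow_of_exponent_le (x := 2) (by norm_num) (show 1 ≤ a * k / 2 by linarith)
    rwa [Real.rpow_one] at this
  have hzz : (2 : ℝ) ^ (a * k) = z * z := by
    rw [hz, ← Real.rpow_add (by norm_num)]
    congr 1
    ring
  have hle : (2 : ℝ) ^ (a / (6 * K) * ((edgeDNF y).size : ℝ)) ≤ z :=
    Real.rpow_le_rpow_of_exponent_le (by norm_num) hexp
  rw [hzz] at hlow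
  nlinarith

end NNF

/-- No polynomial dominates an exponential function. -/
theorem exists_forall_eval_lt_rpow (p : Polynomial ℕ) {c : ℝ} (hc : 0 < c) :
    ∃ N : ℕ, ∀ n : ℕ, N ≤ n → ((p.eval n : ℕ) : ℝ) < 2 ^ (c * (n : ℝ)) := by
  set a : ℝ := Real.log 2 * c with ha
  have ha0 : 0 < a := mul_pos (Real.log_pos (by norm_num)) hc
  -- Since 2^(cn) = exp(an), rescaling the variable by a reduces the claim to the domination of
  -- polynomials by exp.
  let q : Polynomial ℝ := (p.map (Nat.castRingHom ℝ)).comp (Polynomial.C a⁻¹ * Polynomial.X)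
  have hq : ∀ n : ℕ, q.eval (a * n) = ((p.eval n : ℕ) : ℝ) := by
    intro n
    have h : a⁻¹ * (a * n) = ((Nat.castRingHom ℝ) n : ℝ) := by
      rw [inv_mul_cancel_left₀ ha0.ne']
      rfl
    simp only [q, Polynomial.eval_comp, Polynomial.eval_mul, Polynomial.eval_C, Polynomial.eval_X]
    rw [h, Polynomial.eval_map_apply]
    rfl
  have hlim := (Polynomial.tendsto_div_exp_atTop q).comp
    (tendsto_natCast_atTop_atTop.const_mul_atTop ha0)
  obtain ⟨N, hN⟩ := Filter.eventually_atTop.1 (hlim.eventually_lt_const zero_lt_one)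
  refine ⟨N, fun n hn => ?_⟩
  have h := hN n hn
  simp only [Function.comp_apply, hq] at h
  rw [div_lt_one (Real.exp_pos _)] at h
  rwa [Real.rpow_def_of_pos (by norm_num), ← mul_assoc]

/-- There are a class of 2-DNFs, all of them DNNFs and of unbounded size, and a constant `c > 0`
such that every DNNF equivalent to the negation of a member `D` has size at least
`2 ^ (c * size D)`. Consequently no polynomial bounds the size of a smallest DNNF for `¬ D` in terms
of the size of the DNNF `D`. -/
theorem mainTheorem4 {X : Type*} [Countable X] [Infinite X] :
    (∃ (𝒟 : Set (NNF X)) (c : ℝ), 0 < c ∧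
      (∀ N : ℕ, ∃ D ∈ 𝒟, N ≤ D.size) ∧
      ∀ D ∈ 𝒟, D.IsDNNF ∧ D.IsKDNF 2 ∧
        ∀ D' : NNF X, D'.IsDNNF → D'.EquivNeg D →
          (2 : ℝ) ^ (c * (D.size : ℝ)) ≤ (D'.size : ℝ)) ∧
    ¬ ∃ p : Polynomial ℕ, ∀ D : NNF X, D.IsDNNF →
        ∃ D' : NNF X, D'.IsDNNF ∧ D'.EquivNeg D ∧ D'.size ≤ p.eval D.size := by
  obtain ⟨c, hc, hD⟩ := NNF.exists_hard_dnf X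
  choose D hsize hdnnf hkdnf hlow using hD
  refine ⟨⟨Set.range D, c, hc, fun N => ⟨D N, ⟨N, rfl⟩, hsize N⟩, ?_⟩, ?_⟩
  · rintro _ ⟨N, rfl⟩
    exact ⟨hdnnf N, hkdnf N, hlow N⟩
  · rintro ⟨p, hp⟩
    obtain ⟨N, hN⟩ := exists_forall_eval_lt_rpow p hc
    obtain ⟨D', h1, h2, h3⟩ := hp (D N) (hdnnf N)
    have h4 : (D'.size : ℝ) ≤ (p.eval (D N).size : ℕ) := by exact_mod_cast h3
    exact absurd ((hlow N D' h1 h2).trans h4) (not_le.2 (hN _ (hsize N)))
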